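/- Let $k\ge 1$ be a fixed integer. An instance of $k$-CRCS ($k$-Coloring Reconfiguration under Color Swapping) consists of a finite simple graph $G$ and two proper $k$-colorings $f_s,f_t\colon V(G)\to\{1,\dots,k\}$. Two proper $k$-colorings $f,f'$ of $G$ are adjacent if there is exactly one edge $uv\in E(G)$ with $f(u)=f'(v)$ and $f(v)=f'(u)$, and $f(w)=f'(w)$ for all $w\in V(G)\setminus\{u,v\}$. They are reconfigurable if there is a finite sequence of proper $k$-colorings of $G$ starting with $f$ and ending with $f'$ in which consecutive colorings are adjacent. A graph is split if its vertex set can be partitioned into a clique and an independent set. Then $k$-CRCS on split graphs is solvable in polynomial time: there are a deterministic Turing machine and a polynomial $p$ such that on every instance $(G,f_s,f_t)$ of $k$-CRCS, written as a word of length $N$ (the colors of the vertices under $f_s$ and $f_t$ together with the adjacency matrix of $G$), the machine halts after at most $p(N)$ steps and decides whether $G$ is a split graph and $f_s$ and $f_t$ are reconfigurable. In particular, on split graphs it decides whether $f_s$ and $f_t$ are reconfigurable. -/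

import Mathlib

namespace ColorSwap

/-- Two proper `k`-colorings `f`, `f'` of `G` are adjacent under color swapping: there is exactly
one edge `uv` with `f u = f' v` and `f v = f' u`, and `f`, `f'` agree on all vertices other than
`u` and `v`. -/
def SwapAdj {V : Type} {G : SimpleGraph V} {k : ℕ} (f f' : G.Coloring (Fin k)) : Prop :=
  ∃ u v : V, G.Adj u v ∧ f u = f' v ∧ f v = f' u ∧
    (∀ x y : V, G.Adj x y → f x = f' y → f y = f' x → s(x, y) = s(u, v)) ∧
    ∀ w : V, w ≠ u → w ≠ v → f w = f' w

/-- There is a finite sequence of proper `k`-colorings from `f` to `f'`, consecutive ones being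
adjacent under color swapping. -/
def Reconfigurable {V : Type} {G : SimpleGraph V} {k : ℕ} (f f' : G.Coloring (Fin k)) : Prop :=
  Relation.ReflTransGen SwapAdj f f'

/-- The vertex set is the union of a clique and an independent set. -/
def IsSplit {V : Type} (G : SimpleGraph V) : Prop :=
  ∃ C I : Set V, C ∪ I = Set.univ ∧ Disjoint C I ∧ G.IsClique C ∧ G.IsIndepSet I

/-- An instance of `k`-CRCS: a finite graph with two proper `k`-colorings. -/
structure Instance (k : ℕ) where
  n : ℕ
  graph : SimpleGraph (Fin n)
  fs : graph.Coloring (Fin k)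
  ft : graph.Coloring (Fin k)

/-- The finite input alphabet: adjacency bits, and pairs of colors. -/
abbrev Symbol (k : ℕ) : Type := Bool ⊕ (Fin k × Fin k)

open scoped Classical in
/-- The block of a vertex `v`: its initial and target color, then row `v` of the adjacency
matrix. -/
noncomputable def Instance.block {k : ℕ} (I : Instance k) (v : Fin I.n) : List (Symbol k) :=
  Sum.inr (I.fs v, I.ft v) ::
    (List.finRange I.n).map fun w => Sum.inl (decide (I.graph.Adj v w))

/-- An instance with `n` vertices is written as the `n` blocks of its vertices, so as a word of
length `n * (n + 1)`. -/
noncomputable def Instance.encode {k : ℕ} (I : Instance k) : List (Symbol k) :=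
  (List.finRange I.n).flatMap I.block

/-- The decision problem `P` on inputs of type `α`, written as words by `enc`, is decided by a
deterministic (multi-stack) Turing machine that halts within a number of steps polynomial in the
length of the input word. -/
def SolvableInPolyTime {α Γ : Type} (enc : α → List Γ) (P : α → Prop) : Prop :=
  ∃ f : α → Bool, (∀ a, f a = true ↔ P a) ∧
    Nonempty (Turing.TM2ComputableInPolyTime enc Computability.encodeBool f)

end ColorSwap

/-! Two vertices with the same neighbors and the same current color are frozen: if one swapped with
a neighbor, that neighbor would receive a color still present on the other, to which it is also
adjacent. Call vertices twins if they agree in initial color, target color and neighborhood. Keeping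
at most two vertices of each twin class changes neither splitness nor reconfigurability
(`HasTwins.isSplit_iff`, `HasTwins.reconfigurable_iff`), because a discarded vertex leaves two
frozen twins behind and must itself be frozen.

In a split graph the clique vertices have distinct colors, so the number of twin classes is bounded
in terms of `k` alone (`exists_key_of_isSplit`). Hence the reduced instance has at most
`selectionBound k` vertices, and its answer can be built into the transition function of a finite
control. If more vertices are selected, the graph is not split.

The reduction needs one pass over the rows of the adjacency matrix. For every vertex a stack holds a
column of bits, its adjacencies to the vertices selected so far; while a row is read against these
columns, it is compared with all selected rows at once. `Instance.run_encode` shows that this takes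
linearly many steps in the length of the word, and `StackAutomaton.solvableInPolyTime` turns the
automaton into a Turing machine. -/

namespace ColorSwap

/-! ### Frozen twins and the reduction to two vertices per twin class -/

section Kernel

variable {V : Type} {G : SimpleGraph V} {k : ℕ}

/-- Uniqueness of the swapped edge is automatic: an endpoint outside `u`, `v` keeps its color, so a
second such edge would be monochromatic under `f'`. -/
theorem SwapAdj.of_swap {f f' : G.Coloring (Fin k)} {u v : V} (huv : G.Adj u v) (h₁ : f u = f' v)
    (h₂ : f v = f' u) (h₃ : ∀ w, w ≠ u → w ≠ v → f w = f' w) : SwapAdj f f' := by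
  refine ⟨u, v, huv, h₁, h₂, fun x y hxy hx hy => ?_, h₃⟩
  have := f.valid hxy
  have := f'.valid hxy
  have := f.valid huv
  by_cases hxu : x = u <;> by_cases hxv : x = v <;> by_cases hyu : y = u <;>
    by_cases hyv : y = v <;> simp_all

/-- Distinct vertices with the same neighbors and the same color keep that color. -/
theorem SwapAdj.eq_of_twins {f f' : G.Coloring (Fin k)} (h : SwapAdj f f') {x y : V} (hxy : x ≠ y)
    (hN : ∀ w, G.Adj x w ↔ G.Adj y w) (hc : f x = f y) : f' x = f x := by
  obtain ⟨u, v, huv, h₁, h₂, -, h₃⟩ := h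
  -- If `x` were swapped with `v`, then `v` would take the color of `y`, which is unchanged and
  -- adjacent to `v`.
  have aux : ∀ u v, G.Adj u v → f u = f' v → f v = f' u → (∀ w, w ≠ u → w ≠ v → f w = f' w) →
      x ≠ u := by
    rintro u v huv h₁ h₂ h₃ rfl
    have hyv : G.Adj y v := (hN v).1 huv
    have := f'.valid hyv
    rw [← h₃ y (Ne.symm hxy) hyv.ne, ← h₁, hc] at this
    exact this rfl
  exact (h₃ x (aux u v huv h₁ h₂ h₃)
    (aux v u huv.symm h₂ h₁ fun w hw hw' => h₃ w hw' hw)).symm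

/-- Both colors are carried through the induction, since the one-step lemma needs the twins to agree
at the current coloring. -/
theorem Reconfigurable.eq_of_twins {f f' : G.Coloring (Fin k)} (h : Reconfigurable f f') {x y : V}
    (hxy : x ≠ y) (hN : ∀ w, G.Adj x w ↔ G.Adj y w) (hc : f x = f y) :
    f' x = f x ∧ f' y = f y := by
  induction h with
  | refl => exact ⟨rfl, rfl⟩
  | tail _ h ih =>
    have e : _ = _ := ih.1.trans (hc.trans ih.2.symm)
    exact ⟨(h.eq_of_twins hxy hN e).trans ih.1,
      (h.eq_of_twins hxy.symm (fun w => (hN w).symm) e.symm).trans ih.2⟩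

variable {W : Type} {H : SimpleGraph W}

/-- Every vertex outside the range of `φ` has two distinct twins in the range of `φ`: vertices with
the same neighbors and the same initial and target color. -/
def HasTwins (φ : H ↪g G) (fs ft : G.Coloring (Fin k)) : Prop :=
  ∀ v, v ∉ Set.range φ → ∃ a b : W, a ≠ b ∧ ∀ c ∈ ({a, b} : Set W),
    fs (φ c) = fs v ∧ ft (φ c) = ft v ∧ ∀ w, G.Adj (φ c) w ↔ G.Adj v w

theorem HasTwins.isSplit_iff {φ : H ↪g G} {fs ft : G.Coloring (Fin k)} (hφ : HasTwins φ fs ft) :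
    IsSplit G ↔ IsSplit H := by
  constructor
  · rintro ⟨C, I, hu, hd, hC, hI⟩
    refine ⟨φ ⁻¹' C, φ ⁻¹' I, by rw [← Set.preimage_union, hu, Set.preimage_univ],
      hd.preimage φ, fun x hx y hy hxy => ?_, fun x hx y hy hxy => ?_⟩
    · exact φ.map_adj_iff.1 (hC hx hy (φ.injective.ne hxy))
    · exact fun h => hI hx hy (φ.injective.ne hxy) (φ.map_adj_iff.2 h)
  · rintro ⟨C, I, hu, hd, hC, hI⟩
    -- Every vertex off the clique has the neighborhood of some `φ a` with `a ∈ I`: two twins are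
    -- never adjacent, so they cannot both lie in `C`. An edge off the clique would thus give an
    -- edge inside `I`.
    have tw : ∀ v, v ∉ φ '' C → ∃ a ∈ I, ∀ w, G.Adj (φ a) w ↔ G.Adj v w := by
      intro v hv
      by_cases hr : v ∈ Set.range φ
      · obtain ⟨a, rfl⟩ := hr
        have : a ∈ C ∪ I := hu ▸ Set.mem_univ a
        exact ⟨a, this.resolve_left fun h => hv ⟨a, h, rfl⟩, fun _ => Iff.rfl⟩
      · obtain ⟨a, b, hab, h⟩ := hφ v hr
        have ha := (h a (by simp)).2.2
        have hb := (h b (by simp)).2.2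
        have hn : ¬ H.Adj a b := by
          intro h'
          have h₁ : G.Adj (φ a) (φ b) := φ.map_adj_iff.2 h'
          have := (hb (φ b)).2 ((ha (φ b)).1 h₁)
          exact G.irrefl this
        have hau : a ∈ C ∪ I := hu ▸ Set.mem_univ a
        have hbu : b ∈ C ∪ I := hu ▸ Set.mem_univ b
        rcases hau with haC | haI
        · rcases hbu with hbC | hbI
          · exact absurd (hC haC hbC hab) hn
          · exact ⟨b, hbI, hb⟩
        · exact ⟨a, haI, ha⟩
    refine ⟨φ '' C, (φ '' C)ᶜ, Set.union_compl_self _, disjoint_compl_right, ?_, ?_⟩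
    · rintro _ ⟨x, hx, rfl⟩ _ ⟨y, hy, rfl⟩ hxy
      exact φ.map_adj_iff.2 (hC hx hy fun h => hxy (h ▸ rfl))
    · intro x hx y hy _ hadj
      obtain ⟨a, ha, ha'⟩ := tw x hx
      obtain ⟨b, hb, hb'⟩ := tw y hy
      have h₁ : G.Adj (φ b) (φ a) := (hb' _).2 ((ha' y).2 hadj).symm
      exact hI hb ha (fun h => G.irrefl (h ▸ h₁ : G.Adj (φ a) (φ a))) (φ.map_adj_iff.1 h₁)

/-- A vertex outside the range of `φ` has a twin and is frozen, so both endpoints of every swap lie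
in the range and the whole sequence restricts to `H`. -/
theorem Reconfigurable.comap {φ : H ↪g G} {fs ft : G.Coloring (Fin k)} (hφ : HasTwins φ fs ft)
    {gs : H.Coloring (Fin k)} (hs : ∀ w, gs w = fs (φ w)) {f : G.Coloring (Fin k)}
    (h : Reconfigurable fs f) {g : H.Coloring (Fin k)} (hg : ∀ w, g w = f (φ w)) :
    Reconfigurable gs g := by
  induction h generalizing g with
  | refl =>
    obtain rfl : gs = g := DFunLike.ext _ _ fun w => (hs w).trans (hg w).symm
    exact .refl
  | @tail f₁ f₂ h₁ h₂ ih =>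
    let g₁ : H.Coloring (Fin k) := f₁.comp φ.toHom
    refine (ih (g := g₁) fun _ => rfl).tail ?_
    have out : ∀ v, v ∉ Set.range φ → f₂ v = f₁ v := by
      intro v hv
      obtain ⟨a, b, hab, h⟩ := hφ v hv
      have ha := h a (by simp)
      have hva : v ≠ φ a := fun e => hv ⟨a, e.symm⟩
      have hN : ∀ w, G.Adj v w ↔ G.Adj (φ a) w := fun w => (ha.2.2 w).symm
      have r₁ := Reconfigurable.eq_of_twins h₁ hva hN ha.1.symm
      have r₂ := Reconfigurable.eq_of_twins (h₁.tail h₂) hva hN ha.1.symm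
      exact r₂.1.trans r₁.1.symm
    obtain ⟨u, v, huv, e₁, e₂, -, e₃⟩ := h₂
    have hu : u ∈ Set.range φ := by
      by_contra hu
      exact f₁.valid huv ((out u hu).symm.trans e₂.symm)
    have hv : v ∈ Set.range φ := by
      by_contra hv
      exact f₁.valid huv (e₁.trans (out v hv))
    obtain ⟨a, rfl⟩ := hu
    obtain ⟨b, rfl⟩ := hv
    refine SwapAdj.of_swap (φ.map_adj_iff.1 huv) (e₁.trans (hg b).symm) (e₂.trans (hg a).symm)
      fun w hw hw' => (e₃ _ (φ.injective.ne hw) (φ.injective.ne hw')).trans (hg w).symm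

/-- An outside vertex has two twins in `H`, which freeze each other. So its initial color is also
the current color of a twin, and properness is inherited from `g`. -/
theorem HasTwins.valid_extend {φ : H ↪g G} {fs ft : G.Coloring (Fin k)} (hφ : HasTwins φ fs ft)
    {gs : H.Coloring (Fin k)} (hs : ∀ w, gs w = fs (φ w)) {g : H.Coloring (Fin k)}
    (h : Reconfigurable gs g) {F : V → Fin k} (hF : ∀ w, F (φ w) = g w)
    (hF' : ∀ v, v ∉ Set.range φ → F v = fs v) {v w : V} (hvw : G.Adj v w) : F v ≠ F w := by
  have tw : ∀ v, ∃ a, F v = g a ∧ ∀ w, G.Adj (φ a) w ↔ G.Adj v w := by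
    intro v
    by_cases hv : v ∈ Set.range φ
    · obtain ⟨a, rfl⟩ := hv
      exact ⟨a, hF a, fun _ => Iff.rfl⟩
    · obtain ⟨a, b, hab, h'⟩ := hφ v hv
      have ha := h' a (by simp)
      have hb := h' b (by simp)
      have := h.eq_of_twins hab (fun w => by
        rw [← φ.map_adj_iff, ← φ.map_adj_iff, ha.2.2, hb.2.2]) (by rw [hs, hs, ha.1, hb.1])
      exact ⟨a, by rw [hF' v hv, this.1, hs, ha.1], ha.2.2⟩
  obtain ⟨a, ha, ha'⟩ := tw v
  obtain ⟨b, hb, hb'⟩ := tw w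
  have h₁ : G.Adj (φ b) (φ a) := (hb' _).2 ((ha' w).2 hvw).symm
  rw [ha, hb]
  exact (g.valid (φ.map_adj_iff.1 h₁)).symm

theorem Reconfigurable.extend {φ : H ↪g G} {fs ft : G.Coloring (Fin k)} (hφ : HasTwins φ fs ft)
    {gs : H.Coloring (Fin k)} (hs : ∀ w, gs w = fs (φ w)) {g : H.Coloring (Fin k)}
    (h : Reconfigurable gs g) {f : G.Coloring (Fin k)} (hf : ∀ w, f (φ w) = g w)
    (hf' : ∀ v, v ∉ Set.range φ → f v = fs v) : Reconfigurable fs f := by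
  induction h generalizing f with
  | refl =>
    obtain rfl : fs = f := DFunLike.ext _ _ fun v => by
      by_cases hv : v ∈ Set.range φ
      · obtain ⟨a, rfl⟩ := hv
        exact (hs a).symm.trans (hf a).symm
      · exact (hf' v hv).symm
    exact .refl
  | @tail g₁ g₂ h₁ h₂ ih =>
    classical
    let F : V → Fin k := fun v => if hv : v ∈ Set.range φ then g₁ hv.choose else fs v
    have hF : ∀ w, F (φ w) = g₁ w := fun w => by
      have hw : φ w ∈ Set.range φ := ⟨w, rfl⟩
      simp only [F, dif_pos hw]
      rw [φ.injective hw.choose_spec]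
    have hF' : ∀ v, v ∉ Set.range φ → F v = fs v := fun v hv => dif_neg hv
    let f₁ : G.Coloring (Fin k) :=
      SimpleGraph.Coloring.mk F fun {_ _} hvw => hφ.valid_extend hs h₁ hF hF' hvw
    refine (ih (f := f₁) hF hF').tail ?_
    obtain ⟨u, v, huv, e₁, e₂, -, e₃⟩ := h₂
    refine SwapAdj.of_swap (φ.map_adj_iff.2 huv) ((hF u).trans (e₁.trans (hf v).symm))
      ((hF v).trans (e₂.trans (hf u).symm)) fun w hw hw' => ?_
    by_cases hr : w ∈ Set.range φ
    · obtain ⟨a, rfl⟩ := hr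
      exact (hF a).trans ((e₃ a (fun e => hw (e ▸ rfl)) fun e => hw' (e ▸ rfl)).trans (hf a).symm)
    · exact (hF' w hr).trans (hf' w hr).symm

theorem HasTwins.reconfigurable_iff {φ : H ↪g G} {fs ft : G.Coloring (Fin k)}
    (hφ : HasTwins φ fs ft) {gs gt : H.Coloring (Fin k)} (hs : ∀ w, gs w = fs (φ w))
    (ht : ∀ w, gt w = ft (φ w)) : Reconfigurable fs ft ↔ Reconfigurable gs gt := by
  refine ⟨fun h => h.comap hφ hs ht, fun h => h.extend hφ hs (fun w => (ht w).symm) fun v hv => ?_⟩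
  -- The extension leaves `v` at its initial color; this is its target color because the frozen twin
  -- `a` has the same two colors.
  obtain ⟨a, b, hab, h'⟩ := hφ v hv
  have ha := h' a (by simp)
  have hb := h' b (by simp)
  have := h.eq_of_twins hab (fun w => by
    rw [← φ.map_adj_iff, ← φ.map_adj_iff, ha.2.2, hb.2.2]) (by rw [hs, hs, ha.1, hb.1])
  rw [← ha.2.1, ← ht, this.1, hs, ha.1]

/-- In a split graph, the colors of a vertex, its membership in the clique and the colors of its
neighbors in the clique determine its neighbors. -/
theorem exists_key_of_isSplit (hG : IsSplit G) (fs ft : G.Coloring (Fin k)) :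
    ∃ key : V → (Fin k × Fin k) × Prop × Set (Fin k), ∀ u v, key u = key v →
      fs u = fs v ∧ ft u = ft v ∧ ∀ w, G.Adj u w ↔ G.Adj v w := by
  obtain ⟨C, I, hu, hd, hC, hI⟩ := hG
  refine ⟨fun v => ((fs v, ft v), v ∈ C, {c | ∃ w ∈ C, G.Adj v w ∧ fs w = c}), fun u v h => ?_⟩
  simp only [Prod.mk.injEq, Set.ext_iff, Set.mem_ofPred_eq] at h
  obtain ⟨⟨hs, ht⟩, hm, hN⟩ := h
  refine ⟨hs, ht, ?_⟩
  -- A proper coloring is injective on a clique, so a set of clique vertices can be recovered from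
  -- its colors.
  have hinj : ∀ x ∈ C, ∀ y ∈ C, fs x = fs y → x = y := fun x hx y hy e => by
    by_contra hxy
    exact fs.valid (hC hx hy hxy) e
  by_cases huC : u ∈ C
  · obtain rfl := hinj u huC v (hm ▸ huC) hs
    exact fun _ => Iff.rfl
  · have hCof : ∀ x, x ∉ C → x ∈ I := fun x hx =>
      (hu ▸ Set.mem_univ x : x ∈ C ∪ I).resolve_left hx
    have aux : ∀ u v, u ∉ C → (∀ c, (∃ w ∈ C, G.Adj u w ∧ fs w = c) →
        ∃ w ∈ C, G.Adj v w ∧ fs w = c) → ∀ w, G.Adj u w → G.Adj v w := by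
      intro u v huC h w hw
      have hwC : w ∈ C := by
        by_contra hwC
        exact hI (hCof u huC) (hCof w hwC) hw.ne hw
      obtain ⟨w', hw', ha, he⟩ := h _ ⟨w, hwC, hw, rfl⟩
      rwa [hinj _ hw' _ hwC he] at ha
    have hvC : v ∉ C := hm ▸ huC
    exact fun w => ⟨aux u v huC (fun c => (hN c).1) w, aux v u hvC (fun c => (hN c).2) w⟩

end Kernel

/-! ### Stack automata and their simulation by Turing machines -/

open Turing

/-- What a stack automaton does to one stack in one step. -/
inductive StackAction (A : Type) where
  | keep : StackAction A
  | pop : StackAction A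
  | push : A → StackAction A

/-- The effect of an action on the contents of a stack. -/
def StackAction.apply {A : Type} : StackAction A → List A → List A
  | keep, S => S
  | pop, S => S.tail
  | push a, S => a :: S

/-- A deterministic automaton with stacks indexed by `K`: in one step it reads the control state and
the tops of all stacks, changes the state, and acts on each stack. -/
structure StackAutomaton (K : Type) (Γ : K → Type) (Q : Type) where
  trans : Q → (∀ s, Option (Γ s)) → Q × (∀ s, StackAction (Γ s))
  init : Q
  final : Q
  trans_final : ∀ t, trans final t = (final, fun _ => StackAction.keep)

namespace StackAutomaton

variable {K : Type} {Γ : K → Type} {Q : Type}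

/-- One step on a configuration, which is a state together with the contents of the stacks. -/
def next (A : StackAutomaton K Γ Q) (c : Q × (∀ s, List (Γ s))) : Q × (∀ s, List (Γ s)) :=
  ((A.trans c.1 fun s => (c.2 s).head?).1,
    fun s => ((A.trans c.1 fun s => (c.2 s).head?).2 s).apply (c.2 s))

/-- `A` gets from `c` to `c'` in at most `t` steps. -/
def ReachesIn (A : StackAutomaton K Γ Q) (t : ℕ) (c c' : Q × (∀ s, List (Γ s))) : Prop :=
  ∃ r ≤ t, A.next^[r] c = c'

theorem ReachesIn.refl (A : StackAutomaton K Γ Q) (c : Q × (∀ s, List (Γ s))) :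
    A.ReachesIn 0 c c := ⟨0, le_rfl, rfl⟩

theorem ReachesIn.step {A : StackAutomaton K Γ Q} {c c' : Q × (∀ s, List (Γ s))}
    (h : A.next c = c') : A.ReachesIn 1 c c' := ⟨1, le_rfl, h⟩

theorem ReachesIn.trans {A : StackAutomaton K Γ Q} {s t : ℕ} {c d e : Q × (∀ s, List (Γ s))}
    (h : A.ReachesIn s c d) (h' : A.ReachesIn t d e) : A.ReachesIn (s + t) c e := by
  obtain ⟨r, hr, rfl⟩ := h
  obtain ⟨r', hr', rfl⟩ := h'
  exact ⟨r' + r, by omega, Function.iterate_add_apply _ _ _ _⟩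

theorem ReachesIn.mono {A : StackAutomaton K Γ Q} {s t : ℕ} {c d : Q × (∀ s, List (Γ s))}
    (h : A.ReachesIn s c d) (hst : s ≤ t) : A.ReachesIn t c d :=
  let ⟨r, hr, e⟩ := h
  ⟨r, hr.trans hst, e⟩

theorem next_final (A : StackAutomaton K Γ Q) (S : ∀ s, List (Γ s)) :
    A.next (A.final, S) = (A.final, S) := by
  simp [next, A.trans_final, StackAction.apply]

section Machine

variable [DecidableEq K]

/-- The variables of the simulating machine: the control state and the stack tops it has read. -/
abbrev Store (Γ : K → Type) (Q : Type) : Type := Q × (∀ s, Option (Γ s))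

/-- Read the tops of the listed stacks. -/
def peekAll : List K → TM2.Stmt Γ Unit (Store Γ Q) → TM2.Stmt Γ Unit (Store Γ Q)
  | [], p => p
  | s :: l, p => TM2.Stmt.peek s (fun v o => (v.1, Function.update v.2 s o)) (peekAll l p)

theorem stepAux_peekAll (l : List K) (p : TM2.Stmt Γ Unit (Store Γ Q)) (q : Q)
    (t : ∀ s, Option (Γ s)) (S : ∀ s, List (Γ s)) :
    TM2.stepAux (peekAll l p) (q, t) S =
      TM2.stepAux p (q, fun s => if s ∈ l then (S s).head? else t s) S := by
  induction l generalizing t with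
  | nil => simp [peekAll]
  | cons a l ih =>
    rw [peekAll, TM2.stepAux, ih]
    congr 2
    funext s
    by_cases hs : s = a
    · subst hs; simp
    · simp [hs]

/-- Whether an action is a `pop`. -/
def _root_.ColorSwap.StackAction.isPop {A : Type} : StackAction A → Bool
  | .pop => true
  | _ => false

/-- The symbol pushed by an action. -/
def _root_.ColorSwap.StackAction.pushed {A : Type} : StackAction A → Option A
  | .push a => some a
  | _ => none

/-- Act on the listed stacks as prescribed by the transition function. -/
def actAll (A : StackAutomaton K Γ Q) [∀ s, Inhabited (Γ s)] :
    List K → TM2.Stmt Γ Unit (Store Γ Q) → TM2.Stmt Γ Unit (Store Γ Q)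
  | [], p => p
  | s :: l, p =>
    TM2.Stmt.branch (fun v => ((A.trans v.1 v.2).2 s).isPop)
      (TM2.Stmt.pop s (fun v _ => v) (actAll A l p))
      (TM2.Stmt.branch (fun v => ((A.trans v.1 v.2).2 s).pushed.isSome)
        (TM2.Stmt.push s (fun v => (((A.trans v.1 v.2).2 s).pushed).getD default) (actAll A l p))
        (actAll A l p))

/-- The acting statements never change the variables, so all actions are computed from the tops read
beforehand; `hl` ensures that no stack is acted on twice. -/
theorem stepAux_actAll (A : StackAutomaton K Γ Q) [∀ s, Inhabited (Γ s)] (l : List K)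
    (hl : l.Nodup) (p : TM2.Stmt Γ Unit (Store Γ Q)) (v : Store Γ Q) (S : ∀ s, List (Γ s)) :
    TM2.stepAux (actAll A l p) v S =
      TM2.stepAux p v fun s => if s ∈ l then ((A.trans v.1 v.2).2 s).apply (S s) else S s := by
  induction l generalizing S with
  | nil => simp [actAll]
  | cons a l ih =>
    have key : TM2.stepAux (actAll A (a :: l) p) v S = TM2.stepAux (actAll A l p) v
        (Function.update S a (((A.trans v.1 v.2).2 a).apply (S a))) := by
      rw [actAll]
      cases h : (A.trans v.1 v.2).2 a <;>
        simp [h, StackAction.isPop, StackAction.pushed, StackAction.apply]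
    rw [key, ih hl.of_cons]
    congr 1
    funext s
    by_cases hs : s = a
    · subst hs; simp [(List.nodup_cons.1 hl).1]
    · simp [hs]

open Classical in
/-- The program simulating one step of a stack automaton. -/
noncomputable def program (A : StackAutomaton K Γ Q) [Fintype K] [∀ s, Inhabited (Γ s)] :
    TM2.Stmt Γ Unit (Store Γ Q) :=
  TM2.Stmt.branch (fun v => decide (v.1 = A.final))
    (TM2.Stmt.load (fun _ => (A.init, fun _ => none)) TM2.Stmt.halt)
    (peekAll Finset.univ.toList <| actAll A Finset.univ.toList <|
      TM2.Stmt.load (fun v => ((A.trans v.1 v.2).1, fun _ => none)) <|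
      TM2.Stmt.goto fun _ => ())

/-- The Turing machine simulating a stack automaton. -/
noncomputable def machine (A : StackAutomaton K Γ Q) [Fintype K] [Fintype Q]
    [∀ s, Fintype (Γ s)] [∀ s, Inhabited (Γ s)] (i o : K) : FinTM2 where
  K := K
  k₀ := i
  k₁ := o
  Γ := Γ
  Λ := Unit
  main := ()
  σ := Store Γ Q
  initialState := (A.init, fun _ => none)
  m _ := program A

/-- The configuration of the simulating machine before a simulated step. -/
def machineCfg (c : Q × (∀ s, List (Γ s))) : TM2.Cfg Γ Unit (Store Γ Q) :=
  ⟨some (), (c.1, fun _ => none), c.2⟩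

variable [Fintype K] [∀ s, Inhabited (Γ s)]

theorem step_machine_of_ne (A : StackAutomaton K Γ Q) (c : Q × (∀ s, List (Γ s)))
    (h : c.1 ≠ A.final) :
    TM2.step (fun _ : Unit => program A) (machineCfg c) = some (machineCfg (A.next c)) := by
  simp [machineCfg, program, h, stepAux_peekAll, stepAux_actAll, Finset.nodup_toList, next]

theorem step_machine_final (A : StackAutomaton K Γ Q) (S : ∀ s, List (Γ s)) :
    TM2.step (fun _ : Unit => program A) (machineCfg (A.final, S)) =
      some ⟨none, (A.init, fun _ => none), S⟩ := by
  simp [machineCfg, program]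

/-- The additional step is the halting one, which also resets the variables as `haltList` demands.
-/
theorem evals_of_iterate (A : StackAutomaton K Γ Q) (r : ℕ) (c : Q × (∀ s, List (Γ s)))
    (S : ∀ s, List (Γ s)) (h : A.next^[r] c = (A.final, S)) :
    Nonempty (StateTransition.EvalsToInTime (TM2.step (fun _ : Unit => program A)) (machineCfg c)
      (some ⟨none, (A.init, fun _ => none), S⟩) (r + 1)) := by
  induction r generalizing c with
  | zero =>
    obtain rfl : c = (A.final, S) := h
    exact ⟨⟨⟨1, step_machine_final A S⟩, le_rfl⟩⟩
  | succ r ih =>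
    rw [Function.iterate_succ_apply] at h
    obtain ⟨e⟩ := ih _ h
    -- The final state may be entered before step `r`; the remaining iterations then do nothing and
    -- are not simulated.
    by_cases hc : c.1 = A.final
    · obtain ⟨q, T⟩ := c
      obtain rfl : q = A.final := hc
      rw [next_final] at e
      exact ⟨⟨e.toEvalsTo, e.steps_le_m.trans (Nat.le_succ _)⟩⟩
    · have e₁ : StateTransition.EvalsToInTime (TM2.step (fun _ : Unit => program A)) (machineCfg c)
          (some (machineCfg (A.next c))) 1 := ⟨⟨1, step_machine_of_ne A c hc⟩, le_rfl⟩
      exact ⟨StateTransition.EvalsToInTime.trans _ _ _ _ _ _ e₁ e⟩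

omit [Fintype K] [∀ s, Inhabited (Γ s)] in
theorem dite_stack_eq (i : K) (S : ∀ s, List (Γ s)) (hS : ∀ s, s ≠ i → S s = [])
    (l : List (Γ i)) (hl : S i = l) :
    (fun s => if h : s = i then (by rw [h]; exact l) else ([] : List (Γ s))) = S := by
  subst hl
  funext s
  by_cases hs : s = i
  · subst hs; simp
  · simp [hs, hS]

/-- A problem decided by a stack automaton within a polynomial number of steps is solvable in
polynomial time. -/
theorem solvableInPolyTime [Fintype Q] [∀ s, Fintype (Γ s)] {α : Type} (A : StackAutomaton K Γ Q)
    (i o : K) (eo : Γ o ≃ Bool) (enc : α → List (Γ i)) (P : α → Prop) (p : Polynomial ℕ)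
    (h : ∀ a, ∃ (b : Bool) (S T : ∀ s, List (Γ s)), (b = true ↔ P a) ∧
      A.ReachesIn (p.eval (enc a).length) (A.init, S) (A.final, T) ∧
      S i = enc a ∧ (∀ s, s ≠ i → S s = []) ∧ T o = [eo.symm b] ∧ ∀ s, s ≠ o → T s = []) :
    SolvableInPolyTime enc P := by
  choose f S T hf hr hS hS' hT hT' using h
  refine ⟨f, hf, ⟨⟨⟨machine A i o, Equiv.refl _, eo⟩, p + 1, fun a => ?_⟩⟩⟩
  refine Nonempty.some ?_
  obtain ⟨r, hr, e⟩ := hr a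
  obtain ⟨e⟩ := evals_of_iterate A r _ _ e
  have hi : initList (machine A i o) ((enc a).map (Equiv.refl (Γ i)).invFun) =
      machineCfg (A.init, S a) := by
    unfold initList machineCfg
    congr 1
    exact dite_stack_eq i (S a) (hS' a) _ (by rw [hS]; exact (List.map_id _).symm)
  have hh : haltList (machine A i o) ((Computability.encodeBool (f a)).map eo.invFun) =
      ⟨none, (A.init, fun _ => none), T a⟩ := by
    unfold haltList
    congr 1
    exact dite_stack_eq o (T a) (hT' a) _ (by rw [hT]; rfl)
  have e' : StateTransition.EvalsToInTime (machine A i o).step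
      (initList (machine A i o) ((enc a).map (Equiv.refl (Γ i)).invFun))
      (some (haltList (machine A i o) ((Computability.encodeBool (f a)).map eo.invFun)))
      (r + 1) := by
    rw [hi, hh]
    exact e
  exact ⟨⟨e'.toEvalsTo, e'.steps_le_m.trans (by simpa using hr)⟩⟩

end Machine

end StackAutomaton

/-! ### Greedy selection of at most two vertices per class -/

section Selection

variable {V : Type} (R : V → V → Prop)

open Classical in
/-- One step of the selection: the vertex `v` is added to the list of selected vertices unless two
vertices related to it are already there. The decisions are recorded in a list of flags. -/
noncomputable def selectStep (p : List V × List Bool) (v : V) : List V × List Bool :=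
  if ∃ a ∈ p.1, ∃ b ∈ p.1, a ≠ b ∧ R a v ∧ R b v then (p.1, false :: p.2)
  else (p.1 ++ [v], true :: p.2)

/-- The vertices selected from a list, and the flags in reverse order. -/
noncomputable def select (vs : List V) : List V × List Bool :=
  vs.foldl (selectStep R) ([], [])

theorem select_concat (vs : List V) (v : V) :
    select R (vs ++ [v]) = selectStep R (select R vs) v := by
  simp [select]

theorem select_sublist (vs : List V) : (select R vs).1.Sublist vs := by
  induction vs using List.reverseRecOn with
  | nil => simp [select]
  | append_singleton vs v ih =>
    rw [select_concat, selectStep]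
    split_ifs
    · exact ih.trans (List.sublist_append_left _ _)
    · exact ih.append_right _

theorem mem_select_or (vs : List V) : ∀ v ∈ vs, v ∈ (select R vs).1 ∨
    ∃ a ∈ (select R vs).1, ∃ b ∈ (select R vs).1, a ≠ b ∧ R a v ∧ R b v := by
  induction vs using List.reverseRecOn with
  | nil => simp
  | append_singleton vs v ih =>
    intro w hw
    rw [select_concat, selectStep]
    rw [List.mem_append, List.mem_singleton] at hw
    split_ifs with h
    · rcases hw with hw | rfl
      · exact ih w hw
      · exact Or.inr h
    · rcases hw with hw | rfl
      · rcases ih w hw with h' | ⟨a, ha, b, hb, h'⟩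
        · exact Or.inl (List.mem_append_left _ h')
        · exact Or.inr ⟨a, List.mem_append_left _ ha, b, List.mem_append_left _ hb, h'⟩
      · exact Or.inl (by simp)

theorem select_no_triple (hR : Equivalence R) (vs : List V) (hvs : vs.Nodup) :
    ∀ a ∈ (select R vs).1, ∀ b ∈ (select R vs).1, ∀ c ∈ (select R vs).1,
      a ≠ b → b ≠ c → a ≠ c → R a b → ¬ R b c := by
  induction vs using List.reverseRecOn with
  | nil => simp [select]
  | append_singleton vs v ih =>
    have ih := ih (List.nodup_append.1 hvs).1
    rw [select_concat, selectStep]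
    split_ifs with h
    · exact ih
    · push Not at h
      intro a ha b hb c hc hab hbc hac h₁ h₂
      simp only [List.mem_append, List.mem_singleton] at ha hb hc
      rcases ha with ha | rfl
      · rcases hb with hb | rfl
        · rcases hc with hc | rfl
          · exact ih a ha b hb c hc hab hbc hac h₁ h₂
          · exact h a ha b hb hab (hR.trans h₁ h₂) h₂
        · rcases hc with hc | rfl
          · exact h a ha c hc hac h₁ (hR.symm h₂)
          · exact hbc rfl
      · rcases hb with hb | rfl
        · rcases hc with hc | rfl
          · exact h b hb c hc hbc (hR.symm h₁) (hR.symm (hR.trans h₁ h₂))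
          · exact hac rfl
        · exact hab rfl

/-- A fiber of `key` lies in one class of `R`, and no class contributes three selected vertices, so
each fiber contributes at most two. -/
theorem length_select_le (hR : Equivalence R) (vs : List V) (hvs : vs.Nodup) {A : Type} [Finite A]
    (key : V → A) (hkey : ∀ u v, key u = key v → R u v) :
    (select R vs).1.length ≤ 2 * Nat.card A := by
  classical
  have := Fintype.ofFinite A
  have hnd : (select R vs).1.Nodup := hvs.sublist (select_sublist R vs)
  rw [← List.toFinset_card_of_nodup hnd, Nat.card_eq_fintype_card]
  refine (Finset.card_le_mul_card_image_of_maps_to (f := key) (t := Finset.univ) (by simp) 2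
    fun a _ => ?_).trans (by simp)
  by_contra! h
  obtain ⟨x, hx, y, hy, z, hz, hxy, hxz, hyz⟩ := Finset.two_lt_card.1 h
  simp only [Finset.mem_filter, List.mem_toFinset] at hx hy hz
  exact select_no_triple R hR vs hvs x hx.1 y hy.1 z hz.1 hxy hyz hxz
    (hkey _ _ (hx.2.trans hy.2.symm)) (hkey _ _ (hy.2.trans hz.2.symm))

end Selection

/-! ### The automaton that decides the problem -/

/-- Lists of length at most `M`. -/
abbrev BoundedList (A : Type) (M : ℕ) : Type := {l : List A // l.length ≤ M}

instance BoundedList.finite (A : Type) [Finite A] (M : ℕ) : Finite (BoundedList A M) :=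
  (List.finite_length_le A M).to_subtype

/-- The empty bounded list. -/
def BoundedList.nil (A : Type) (M : ℕ) : BoundedList A M := ⟨[], Nat.zero_le M⟩

/-- A list as a bounded list, if it is short enough. -/
def toBounded {A : Type} (M : ℕ) (l : List A) : Option (BoundedList A M) :=
  if h : l.length ≤ M then some ⟨l, h⟩ else none

/-- Put an element in front of a bounded list, if there is room for it. -/
def BoundedList.cons {A : Type} {M : ℕ} (a : A) (l : BoundedList A M) : BoundedList A M :=
  if h : (a :: l.1).length ≤ M then ⟨a :: l.1, h⟩ else l

/-- The control states of the automaton deciding `k`-CRCS on split graphs. A column is a vector of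
`M` bits, holding the adjacency of one vertex to the selected vertices. The states are: moving the
columns back to the left-hand stack before the next row; reading a row, whose vertex has the color
pair `c`, while recording which selected rows agree with it so far; collecting the columns of the
selected vertices; emptying the stacks; the final state. In the first two, `none` stands for more
than `M` selected vertices. -/
inductive Control (k M : ℕ) : Type where
  | rewind (sel : Option (BoundedList (Fin k × Fin k) M)) : Control k M
  | scan (sel : Option (BoundedList (Fin k × Fin k) M)) (c : Fin k × Fin k) (e : Fin M → Bool) :
      Control k M
  | collect (sel : BoundedList (Fin k × Fin k) M) (cols : BoundedList (Fin M → Bool) M) :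
      Control k M
  | clear (ans : Bool) : Control k M
  | final : Control k M

instance Control.finite (k M : ℕ) : Finite (Control k M) := by
  let C := BoundedList (Fin k × Fin k) M
  let code : Control k M →
      Option C ⊕ (Option C × (Fin k × Fin k) × (Fin M → Bool)) ⊕
        (C × BoundedList (Fin M → Bool) M) ⊕ Bool ⊕ Unit := fun
    | .rewind s => .inl s
    | .scan s c e => .inr (.inl (s, c, e))
    | .collect s t => .inr (.inr (.inl (s, t)))
    | .clear b => .inr (.inr (.inr (.inl b)))
    | .final => .inr (.inr (.inr (.inr ())))
  refine Finite.of_injective code fun x y h => ?_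
  cases x <;> cases y <;> simp_all [code]

noncomputable instance Control.fintype (k M : ℕ) : Fintype (Control k M) := Fintype.ofFinite _

/-- The stacks: input, output, the columns not yet read in the current pass, those already read, and
the flags telling which vertices are selected. -/
inductive Stack : Type where
  | inp | out | todo | done | flags
  deriving DecidableEq

instance Stack.fintype : Fintype Stack :=
  ⟨⟨([.inp, .out, .todo, .done, .flags] : List Stack), by simp⟩, fun s => by cases s <;> simp⟩

/-- The alphabets of the stacks. -/
abbrev Alphabet (k M : ℕ) : Stack → Type
  | .inp => Symbol k
  | .out => Bool
  | .todo => Fin M → Bool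
  | .done => Fin M → Bool
  | .flags => Bool

instance Alphabet.fintype (k M : ℕ) : ∀ s, Fintype (Alphabet k M s)
  | .inp => inferInstanceAs (Fintype (Symbol k))
  | .out => inferInstanceAs (Fintype Bool)
  | .todo => inferInstanceAs (Fintype (Fin M → Bool))
  | .done => inferInstanceAs (Fintype (Fin M → Bool))
  | .flags => inferInstanceAs (Fintype Bool)

instance Alphabet.inhabited (k M : ℕ) : ∀ s, Inhabited (Alphabet k M s)
  | .inp => ⟨Sum.inl false⟩
  | .out => ⟨false⟩
  | .todo => ⟨fun _ => false⟩
  | .done => ⟨fun _ => false⟩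
  | .flags => ⟨false⟩

/-- A dependent function on the stacks, given by its values. -/
def onStacks {k M : ℕ} {F : Type → Type} (i : F (Symbol k)) (o : F Bool) (t d : F (Fin M → Bool))
    (f : F Bool) : ∀ s, F (Alphabet k M s)
  | .inp => i
  | .out => o
  | .todo => t
  | .done => d
  | .flags => f

/-- Write a bit of the row of a new vertex into a column. -/
def writeBit {k M : ℕ} (sel : Option (BoundedList (Fin k × Fin k) M)) (x : Fin M → Bool)
    (b : Bool) : Fin M → Bool :=
  match sel with
  | none => x
  | some l => fun i => if i.1 = l.1.length then b else x i

/-- The color pairs and the columns belong to an instance that is a positive instance of `k`-CRCS on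
split graphs. -/
def Accepts {k M : ℕ} (sel : List (Fin k × Fin k)) (cols : List (Fin M → Bool)) : Prop :=
  ∃ J : Instance k, (List.finRange J.n).map (fun v => (J.fs v, J.ft v)) = sel ∧
    (∀ (v : Fin J.n) (x : Fin M → Bool), cols[v.1]? = some x →
      ∀ (w : Fin J.n) (h : w.1 < M), x ⟨w.1, h⟩ = true ↔ J.graph.Adj w v) ∧
    IsSplit J.graph ∧ Reconfigurable J.fs J.ft

/-- Two selected vertices have the color pair `c` and rows agreeing with the current one. -/
def TwoMatches {k M : ℕ} (l : List (Fin k × Fin k)) (c : Fin k × Fin k) (e : Fin M → Bool) : Prop :=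
  ∃ i j : Fin M, i ≠ j ∧ (l[i.1]? = some c ∧ e i = true) ∧ (l[j.1]? = some c ∧ e j = true)

open Classical in
/-- The transition function of the automaton deciding `k`-CRCS on split graphs. -/
noncomputable def crcsTrans (k M : ℕ) :
    Control k M → (∀ s, Option (Alphabet k M s)) →
      Control k M × (∀ s, StackAction (Alphabet k M s))
  | .rewind sel, t =>
    match t .inp with
    | none =>
      match sel with
      | none => (.clear false, onStacks .keep .keep .keep .keep .keep)
      | some l => (.collect l (BoundedList.nil _ _), onStacks .keep .keep .keep .keep .keep)
    | some a =>
      match t .done with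
      | some x => (.rewind sel, onStacks .keep .keep (.push x) .pop .keep)
      | none =>
        match a with
        | Sum.inr c => (.scan sel c fun _ => true, onStacks .pop .keep .keep .keep .keep)
        | Sum.inl _ => (.clear false, onStacks .keep .keep .keep .keep .keep)
  | .scan sel c e, t =>
    match t .inp with
    | some (Sum.inl b) =>
      (.scan sel c fun i => e i && (((t .todo).getD fun _ => false) i == b),
        onStacks .pop .keep .pop (.push (writeBit sel ((t .todo).getD fun _ => false) b)) .keep)
    | _ =>
      match sel with
      | none => (.rewind none, onStacks .keep .keep .keep .keep (.push false))
      | some l =>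
        if TwoMatches l.1 c e then
          (.rewind (some l), onStacks .keep .keep .keep .keep (.push false))
        else (.rewind (toBounded M (l.1 ++ [c])), onStacks .keep .keep .keep .keep (.push true))
  | .collect sel cols, t =>
    match t .flags with
    | some b =>
      (.collect sel (if b then cols.cons ((t .done).getD fun _ => false) else cols),
        onStacks .keep .keep .keep .pop .pop)
    | none => (.clear (decide (Accepts sel.1 cols.1)), onStacks .keep .keep .keep .keep .keep)
  | .clear ans, t =>
    if (t .inp).isNone ∧ (t .todo).isNone ∧ (t .done).isNone ∧ (t .flags).isNone then
      (.final, onStacks .keep (.push ans) .keep .keep .keep)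
    else (.clear ans, onStacks .pop .keep .pop .pop .pop)
  | .final, _ => (.final, fun _ => .keep)

/-- The automaton deciding `k`-CRCS on split graphs. -/
noncomputable def crcsAutomaton (k M : ℕ) : StackAutomaton Stack (Alphabet k M) (Control k M) where
  trans := crcsTrans k M
  init := .rewind (some (BoundedList.nil _ _))
  final := .final
  trans_final _ := rfl

/-- Configurations, given by the contents of the stacks. -/
def conf {k M : ℕ} (q : Control k M) (i : List (Symbol k)) (o : List Bool)
    (t d : List (Fin M → Bool)) (f : List Bool) :
    Control k M × (∀ s, List (Alphabet k M s)) :=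
  (q, onStacks i o t d f)

/-! ### Running the phases of the automaton -/

section Run

variable {k M : ℕ}

open StackAutomaton

theorem next_conf {q q' : Control k M} {i : List (Symbol k)} {o : List Bool}
    {t d : List (Fin M → Bool)} {f : List Bool} {ai : StackAction (Symbol k)}
    {ao : StackAction Bool} {at' ad : StackAction (Fin M → Bool)} {af : StackAction Bool}
    (h : crcsTrans k M q (fun s => (onStacks (F := List) i o t d f s).head?) =
      (q', onStacks ai ao at' ad af)) :
    (crcsAutomaton k M).ReachesIn 1 (conf q i o t d f)
      (conf q' (ai.apply i) (ao.apply o) (at'.apply t) (ad.apply d) (af.apply f)) := by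
  refine .step (Prod.ext ?_ (funext fun s => ?_))
  · exact (congrArg Prod.fst h : (crcsTrans k M q _).1 = q')
  · have := congrFun (congrArg Prod.snd h) s
    change ((crcsTrans k M q fun s => (onStacks (F := List) i o t d f s).head?).2 s).apply
      (onStacks (F := List) i o t d f s) = _
    rw [this]
    cases s <;> rfl

theorem run_rewind (sel : Option (BoundedList (Fin k × Fin k) M)) (a : Symbol k)
    (i : List (Symbol k)) (f : List Bool) (t d : List (Fin M → Bool)) :
    (crcsAutomaton k M).ReachesIn d.length (conf (.rewind sel) (a :: i) [] t d f)
      (conf (.rewind sel) (a :: i) [] (d.reverse ++ t) [] f) := by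
  induction d generalizing t with
  | nil => exact .refl _ _
  | cons x d ih =>
    have h : (crcsAutomaton k M).ReachesIn 1 (conf (.rewind sel) (a :: i) [] t (x :: d) f)
        (conf (.rewind sel) (a :: i) [] (x :: t) d f) :=
      next_conf (ai := .keep) (ao := .keep) (at' := .push x) (ad := .pop) (af := .keep) rfl
    simpa [add_comm] using h.trans (ih (x :: t))

theorem run_header (sel : Option (BoundedList (Fin k × Fin k) M)) (c : Fin k × Fin k)
    (i : List (Symbol k)) (f : List Bool) (t : List (Fin M → Bool)) :
    (crcsAutomaton k M).ReachesIn 1 (conf (.rewind sel) (Sum.inr c :: i) [] t [] f)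
      (conf (.scan sel c fun _ => true) i [] t [] f) :=
  next_conf (ai := .pop) (ao := .keep) (at' := .keep) (ad := .keep) (af := .keep) rfl

/-- The second alternative of `ht` covers the first row: no columns exist yet, and a missing column
is read as the all-false one. -/
theorem run_scan {V : Type} (sel : Option (BoundedList (Fin k × Fin k) M)) (c : Fin k × Fin k)
    (e : Fin M → Bool) (i : List (Symbol k)) (f : List Bool) (ws : List V) (bit : V → Bool)
    (X : V → Fin M → Bool) (t d : List (Fin M → Bool))
    (ht : t = ws.map X ∨ t = [] ∧ ∀ w, X w = fun _ => false) :
    (crcsAutomaton k M).ReachesIn ws.length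
      (conf (.scan sel c e) ((ws.map fun w => Sum.inl (bit w)) ++ i) [] t d f)
      (conf (.scan sel c fun j => e j && ws.all fun w => X w j == bit w) i [] []
        ((ws.map fun w => writeBit sel (X w) (bit w)).reverse ++ d) f) := by
  induction ws generalizing e t d with
  | nil =>
    have : t = [] := by simpa using ht.imp_right And.left
    simpa [this] using ReachesIn.refl _ _
  | cons w ws ih =>
    have hd : (t.head?).getD (fun _ => false) = X w := by
      rcases ht with rfl | ⟨rfl, h⟩
      · rfl
      · exact (h w).symm
    have ht' : t.tail = ws.map X ∨ t.tail = [] ∧ ∀ w, X w = fun _ => false :=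
      ht.imp (fun h => by simp [h]) (fun h => ⟨by simp [h.1], h.2⟩)
    have h : (crcsAutomaton k M).ReachesIn 1
        (conf (.scan sel c e) (Sum.inl (bit w) :: ((ws.map fun w => Sum.inl (bit w)) ++ i)) [] t d f)
        (conf (.scan sel c fun j => e j && (X w j == bit w))
          ((ws.map fun w => Sum.inl (bit w)) ++ i) [] t.tail
          (writeBit sel (X w) (bit w) :: d) f) := by
      refine next_conf (ai := .pop) (ao := .keep) (at' := .pop)
        (ad := .push (writeBit sel (X w) (bit w))) (af := .keep) ?_
      rw [← hd]
      rfl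
    simpa [add_comm, Bool.and_assoc] using h.trans (ih _ _ _ ht')

open Classical in
theorem run_scan_end (sel : Option (BoundedList (Fin k × Fin k) M)) (c : Fin k × Fin k)
    (e : Fin M → Bool) (i : List (Symbol k)) (hi : ∀ b, i.head? ≠ some (Sum.inl b))
    (f : List Bool) (t d : List (Fin M → Bool)) :
    (crcsAutomaton k M).ReachesIn 1 (conf (.scan sel c e) i [] t d f)
      (match sel with
      | none => conf (.rewind none) i [] t d (false :: f)
      | some l =>
        if TwoMatches l.1 c e then conf (.rewind (some l)) i [] t d (false :: f)
        else conf (.rewind (toBounded M (l.1 ++ [c]))) i [] t d (true :: f)) := by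
  have key : crcsTrans k M (.scan sel c e)
      (fun s => (onStacks (k := k) (M := M) (F := List) i [] t d f s).head?) =
      match sel with
      | none => (.rewind none, onStacks .keep .keep .keep .keep (.push false))
      | some l =>
        if TwoMatches l.1 c e then
          (.rewind (some l), onStacks .keep .keep .keep .keep (.push false))
        else (.rewind (toBounded M (l.1 ++ [c])),
          onStacks .keep .keep .keep .keep (.push true)) := by
    match i, hi with
    | [], _ => rfl
    | Sum.inr _ :: _, _ => rfl
    | Sum.inl b :: _, hi => exact absurd rfl (hi b)
  cases sel with
  | none => exact next_conf key
  | some l =>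
    simp only at key ⊢
    split_ifs at key ⊢
    · exact next_conf key
    · exact next_conf key

theorem run_rewind_end_none (t d : List (Fin M → Bool)) (f : List Bool) :
    (crcsAutomaton k M).ReachesIn 1 (conf (.rewind none) [] [] t d f)
      (conf (.clear false) [] [] t d f) :=
  next_conf (ai := .keep) (ao := .keep) (at' := .keep) (ad := .keep) (af := .keep) rfl

theorem run_rewind_end_some (l : BoundedList (Fin k × Fin k) M) (t d : List (Fin M → Bool))
    (f : List Bool) :
    (crcsAutomaton k M).ReachesIn 1 (conf (.rewind (some l)) [] [] t d f)
      (conf (.collect l (BoundedList.nil _ _)) [] [] t d f) :=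
  next_conf (ai := .keep) (ao := .keep) (at' := .keep) (ad := .keep) (af := .keep) rfl

/-- Columns and flags both have the last vertex on top, so popping them in parallel and putting the
kept columns in front restores the order of selection. -/
theorem run_collect {V : Type} (R : V → V → Prop) (X : V → Fin M → Bool)
    (sel : BoundedList (Fin k × Fin k) M) (i : List (Symbol k)) (t : List (Fin M → Bool))
    (vs : List V) (d : List (Fin M → Bool)) (f : List Bool) (cols : BoundedList (Fin M → Bool) M)
    (h : ((select R vs).1.map X ++ cols.1).length ≤ M) :
    (crcsAutomaton k M).ReachesIn vs.length
      (conf (.collect sel cols) i [] t ((vs.map X).reverse ++ d) ((select R vs).2 ++ f))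
      (conf (.collect sel ⟨(select R vs).1.map X ++ cols.1, h⟩) i [] t d f) := by
  induction vs using List.reverseRecOn generalizing cols with
  | nil => exact ReachesIn.refl _ _
  | append_singleton vs v ih =>
    have step : ∀ (b : Bool) (F : List Bool), (crcsAutomaton k M).ReachesIn 1
        (conf (.collect sel cols) i [] t (X v :: ((vs.map X).reverse ++ d)) (b :: F))
        (conf (.collect sel (if b then cols.cons (X v) else cols)) i [] t
          ((vs.map X).reverse ++ d) F) := fun b F =>
      next_conf (ai := .keep) (ao := .keep) (at' := .keep) (ad := .pop) (af := .pop) rfl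
    by_cases hv : ∃ a ∈ (select R vs).1, ∃ b ∈ (select R vs).1, a ≠ b ∧ R a v ∧ R b v
    · have e : select R (vs ++ [v]) = ((select R vs).1, false :: (select R vs).2) := by
        rw [select_concat, selectStep, if_pos hv]
      simp only [e] at h ⊢
      have := (step false ((select R vs).2 ++ f)).trans (ih cols h)
      simpa [add_comm] using this
    · have e : select R (vs ++ [v]) = ((select R vs).1 ++ [v], true :: (select R vs).2) := by
        rw [select_concat, selectStep, if_neg hv]
      simp only [e] at h ⊢
      -- The length bound `h` leaves room for `X v`, so `cons` does not fall back to its default.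
      have hc : (cols.cons (X v)).1 = X v :: cols.1 := by
        rw [BoundedList.cons, dif_pos]
        simp at h ⊢
        omega
      have := (step true ((select R vs).2 ++ f)).trans
        (ih (cols.cons (X v)) (by simpa [hc, add_assoc, add_comm, add_left_comm] using h))
      simpa [add_comm, hc] using this

open Classical in
theorem run_collect_end (sel : BoundedList (Fin k × Fin k) M) (cols : BoundedList (Fin M → Bool) M)
    (i : List (Symbol k)) (t d : List (Fin M → Bool)) :
    (crcsAutomaton k M).ReachesIn 1 (conf (.collect sel cols) i [] t d [])
      (conf (.clear (decide (Accepts sel.1 cols.1))) i [] t d []) :=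
  next_conf (ai := .keep) (ao := .keep) (at' := .keep) (ad := .keep) (af := .keep) rfl

theorem run_clear (ans : Bool) (N : ℕ) (i : List (Symbol k)) (t d : List (Fin M → Bool))
    (f : List Bool) (hi : i.length ≤ N) (ht : t.length ≤ N) (hd : d.length ≤ N)
    (hf : f.length ≤ N) :
    (crcsAutomaton k M).ReachesIn (N + 1) (conf (.clear ans) i [] t d f)
      (conf .final [] [ans] [] [] []) := by
  have fin : (crcsAutomaton k M).ReachesIn 1 (conf (.clear ans) [] [] [] [] [])
      (conf .final [] [ans] [] [] []) :=
    next_conf (ai := .keep) (ao := .push ans) (at' := .keep) (ad := .keep) (af := .keep) (by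
      simp [crcsTrans, onStacks])
  induction N generalizing i t d f with
  | zero =>
    simp only [Nat.le_zero, List.length_eq_zero_iff] at hi ht hd hf
    subst hi ht hd hf
    exact fin
  | succ N ih =>
    by_cases h : i = [] ∧ t = [] ∧ d = [] ∧ f = []
    · obtain ⟨rfl, rfl, rfl, rfl⟩ := h
      exact fin.mono (by omega)
    · have step : (crcsAutomaton k M).ReachesIn 1 (conf (.clear ans) i [] t d f)
          (conf (.clear ans) i.tail [] t.tail d.tail f.tail) :=
        next_conf (ai := .pop) (ao := .keep) (at' := .pop) (ad := .pop) (af := .pop) (by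
          simp [crcsTrans, onStacks, h])
      exact (step.trans (ih i.tail t.tail d.tail f.tail (by simp; omega) (by simp; omega)
        (by simp; omega) (by simp; omega))).mono (by omega)

end Run

/-! ### Correctness and running time on encoded instances -/

namespace Instance

variable {k : ℕ} (I : Instance k)

/-- The pair of colors of a vertex. -/
def colors (v : Fin I.n) : Fin k × Fin k := (I.fs v, I.ft v)

/-- Two vertices have the same initial color, target color and neighbors. -/
def Twins (u v : Fin I.n) : Prop := I.colors u = I.colors v ∧ ∀ w, I.graph.Adj u w ↔ I.graph.Adj v w

theorem twins_equivalence : Equivalence I.Twins where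
  refl _ := ⟨rfl, fun _ => Iff.rfl⟩
  symm h := ⟨h.1.symm, fun w => (h.2 w).symm⟩
  trans h h' := ⟨h.1.trans h'.1, fun w => (h.2 w).trans (h'.2 w)⟩

/-- A bound for the number of vertices selected from a split graph. -/
noncomputable def _root_.ColorSwap.selectionBound (k : ℕ) : ℕ :=
  2 * Nat.card ((Fin k × Fin k) × Prop × Set (Fin k))

theorem length_select_le_of_isSplit (h : IsSplit I.graph) (vs : List (Fin I.n)) (hvs : vs.Nodup) :
    (select I.Twins vs).1.length ≤ selectionBound k := by
  obtain ⟨key, hkey⟩ := exists_key_of_isSplit h I.fs I.ft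
  exact length_select_le _ I.twins_equivalence vs hvs key fun u v e =>
    ⟨Prod.ext (hkey u v e).1 (hkey u v e).2.1, (hkey u v e).2.2⟩

theorem length_encode : I.encode.length = I.n * (I.n + 1) := by
  simp [encode, block]

theorem head_flatMap_block (vs : List (Fin I.n)) (b : Bool) :
    (vs.flatMap I.block).head? ≠ some (Sum.inl b) := by
  cases vs <;> simp [block]

variable {M : ℕ}

/-- The contents of the stacks of columns and of flags after the rows of `vs` have been read. -/
def StacksFor (vs : List (Fin I.n)) (d : List (Fin M → Bool)) (f : List Bool) : Prop :=
  f.length = vs.length ∧ ((select I.Twins vs).1.length ≤ M → f = (select I.Twins vs).2) ∧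
    ∃ X : Fin I.n → Fin M → Bool,
      (d = ((List.finRange I.n).map X).reverse ∨ vs = [] ∧ d = [] ∧ ∀ w, X w = fun _ => false) ∧
      ((select I.Twins vs).1.length ≤ M → ∀ (j : Fin M) (u : Fin I.n),
        (select I.Twins vs).1[j.1]? = some u → ∀ w, X w j = true ↔ I.graph.Adj u w)

theorem twoMatches_iff {us : List (Fin I.n)} (hus : us.Nodup) (hM : us.length ≤ M) (v : Fin I.n)
    {e : Fin M → Bool}
    (he : ∀ (j : Fin M) (u : Fin I.n), us[j.1]? = some u →
      (e j = true ↔ ∀ w, I.graph.Adj u w ↔ I.graph.Adj v w)) :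
    TwoMatches (us.map I.colors) (I.colors v) e ↔
      ∃ a ∈ us, ∃ b ∈ us, a ≠ b ∧ I.Twins a v ∧ I.Twins b v := by
  constructor
  · rintro ⟨i, j, hij, ⟨hi, hi'⟩, hj, hj'⟩
    rw [List.getElem?_map, Option.map_eq_some_iff] at hi hj
    obtain ⟨a, ha, ha'⟩ := hi
    obtain ⟨b, hb, hb'⟩ := hj
    refine ⟨a, List.mem_of_getElem? ha, b, List.mem_of_getElem? hb, ?_,
      ⟨ha', (he i a ha).1 hi'⟩, hb', (he j b hb).1 hj'⟩
    rintro rfl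
    obtain ⟨hi, ha⟩ := List.getElem?_eq_some_iff.1 ha
    obtain ⟨hj, hb⟩ := List.getElem?_eq_some_iff.1 hb
    exact hij (Fin.ext ((hus.getElem_inj_iff).1 (ha.trans hb.symm)))
  · rintro ⟨a, ha, b, hb, hab, hav, hbv⟩
    obtain ⟨i, hi, rfl⟩ := List.getElem_of_mem ha
    obtain ⟨j, hj, rfl⟩ := List.getElem_of_mem hb
    refine ⟨⟨i, hi.trans_le hM⟩, ⟨j, hj.trans_le hM⟩, fun h => hab ?_, ⟨?_, ?_⟩, ?_, ?_⟩
    · simp only [Fin.mk.injEq] at h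
      simp [h]
    · simp [hi, hav.1]
    · exact (he _ us[i] (by simp [hi])).2 hav.2
    · simp [hj, hbv.1]
    · exact (he _ us[j] (by simp [hj])).2 hbv.2

-- One row costs at most `n` steps to rewind, one for the header, `n` to scan and one to decide on
-- selection.
open StackAutomaton in
theorem run_row (vs ws : List (Fin I.n)) (v : Fin I.n) (hvs : vs.Nodup)
    (d : List (Fin M → Bool)) (f : List Bool) (h : I.StacksFor vs d f) :
    ∃ d' f', I.StacksFor (vs ++ [v]) d' f' ∧
      (crcsAutomaton k M).ReachesIn (2 * I.n + 2)
        (conf (.rewind (toBounded M ((select I.Twins vs).1.map I.colors)))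
          ((v :: ws).flatMap I.block) [] [] d f)
        (conf (.rewind (toBounded M ((select I.Twins (vs ++ [v])).1.map I.colors)))
          (ws.flatMap I.block) [] [] d' f') := by
  classical
  obtain ⟨hfl, hf, X, hd, hX⟩ := h
  set us := (select I.Twins vs).1 with hus
  have husn : us.Nodup := hvs.sublist (select_sublist _ _)
  set sel := toBounded M (us.map I.colors) with hsel
  let bit : Fin I.n → Bool := fun w => decide (I.graph.Adj v w)
  let e : Fin M → Bool := fun j => true && (List.finRange I.n).all fun w => X w j == bit w
  let d' := ((List.finRange I.n).map fun w => writeBit sel (X w) (bit w)).reverse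
  have hblock : (v :: ws).flatMap I.block = Sum.inr (I.colors v) ::
      (((List.finRange I.n).map fun w => Sum.inl (bit w)) ++ ws.flatMap I.block) := rfl
  have hdl : d.length ≤ I.n := by
    rcases hd with rfl | ⟨-, rfl, -⟩ <;> simp
  have ht : d.reverse ++ [] = (List.finRange I.n).map X ∨
      d.reverse ++ [] = [] ∧ ∀ w, X w = fun _ => false :=
    hd.imp (fun h => by simp [h]) (fun h => ⟨by simp [h.2.1], h.2.2⟩)
  have r₁ := ((run_rewind sel (Sum.inr (I.colors v))
      (((List.finRange I.n).map fun w => Sum.inl (bit w)) ++ ws.flatMap I.block) f [] d).trans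
    (run_header _ _ _ _ _)).trans
    (run_scan sel (I.colors v) (fun _ => true) (ws.flatMap I.block) f (List.finRange I.n) bit X
      _ [] ht)
  rw [← hblock, List.append_nil] at r₁
  have r₂ := r₁.trans (run_scan_end sel (I.colors v) e (ws.flatMap I.block)
    (I.head_flatMap_block ws) f [] d')
  have hn : d.length + 1 + (List.finRange I.n).length + 1 ≤ 2 * I.n + 2 := by
    rw [List.length_finRange]; omega
  replace r₂ := r₂.mono hn
  -- The new row is written at position `us.length`, before it is known whether `v` is selected. The
  -- earlier positions are untouched, and if `v` is rejected this position lies beyond the selection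
  -- and carries no claim.
  have hXw : ∀ (us' : List (Fin I.n)), us'.length ≤ M → (us' = us ∨ us' = us ++ [v]) →
      ∀ (j : Fin M) (u : Fin I.n), us'[j.1]? = some u →
        ∀ w, writeBit sel (X w) (bit w) j = true ↔ I.graph.Adj u w := by
    intro us' hM hor j u hu w
    have hM' : us.length ≤ M := by
      rcases hor with rfl | rfl
      · exact hM
      · simp at hM; omega
    have hs : sel = some ⟨us.map I.colors, by simpa using hM'⟩ := by
      rw [hsel, toBounded, dif_pos]
    simp only [hs, writeBit, List.length_map]
    have old : us[j.1]? = some u →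
        ((if j.1 = us.length then bit w else X w j) = true ↔ I.graph.Adj u w) := by
      intro hu
      have := (List.getElem?_eq_some_iff.1 hu).1
      rw [if_neg (by omega)]
      exact hX hM' j u hu w
    rcases hor with rfl | rfl
    · exact old hu
    · rcases lt_or_ge j.1 us.length with hj | hj
      · rw [List.getElem?_append_left hj] at hu
        exact old hu
      · have hj' : j.1 = us.length := by
          have := (List.getElem?_eq_some_iff.1 hu).1
          simp at this
          omega
        rw [hj'] at hu
        simp only [List.getElem?_concat_length, Option.some.injEq] at hu
        simp [hj', hu, bit]
  by_cases hM : us.length ≤ M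
  · have hs : sel = some ⟨us.map I.colors, by simpa using hM⟩ := by
      rw [hsel, toBounded, dif_pos]
    have hiff : TwoMatches (us.map I.colors) (I.colors v) e ↔
        ∃ a ∈ us, ∃ b ∈ us, a ≠ b ∧ I.Twins a v ∧ I.Twins b v := by
      refine I.twoMatches_iff husn hM v fun j u hu => ?_
      simp only [e, Bool.true_and, List.all_eq_true, List.mem_finRange, beq_iff_eq,
        forall_const]
      refine forall_congr' fun w => ?_
      rw [Bool.eq_iff_iff, hX hM j u hu w]
      simp [bit]
    by_cases htm : ∃ a ∈ us, ∃ b ∈ us, a ≠ b ∧ I.Twins a v ∧ I.Twins b v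
    · have hse : select I.Twins (vs ++ [v]) = (us, false :: (select I.Twins vs).2) := by
        rw [select_concat, selectStep, if_pos htm]
      refine ⟨d', false :: f, ⟨by simp [hfl], ?_, _, Or.inl rfl, ?_⟩, ?_⟩
      · rw [hse]
        exact fun _ => congrArg _ (hf hM)
      · rw [hse]
        exact fun h => hXw us h (Or.inl rfl)
      · rw [hse]
        simp only [hs, if_pos (hiff.2 htm)] at r₂
        simpa only [← hsel, hs] using r₂
    · have hse : select I.Twins (vs ++ [v]) = (us ++ [v], true :: (select I.Twins vs).2) := by
        rw [select_concat, selectStep, if_neg htm]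
      refine ⟨d', true :: f, ⟨by simp [hfl], ?_, _, Or.inl rfl, ?_⟩, ?_⟩
      · rw [hse]
        exact fun _ => congrArg _ (hf hM)
      · rw [hse]
        exact fun h => hXw _ h (Or.inr rfl)
      · rw [hse]
        simp only [hs, if_neg (mt hiff.1 htm)] at r₂
        simpa only [List.map_append, List.map_cons, List.map_nil, hs] using r₂
  · have hs : sel = none := by
      rw [hsel, toBounded, dif_neg (by simpa using hM)]
    have hgt : M < (select I.Twins (vs ++ [v])).1.length := by
      rw [select_concat, selectStep]
      split_ifs
      · exact not_le.1 hM
      · simp only [List.length_append, ← hus]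
        omega
    refine ⟨d', false :: f, ⟨by simp [hfl], fun h => absurd h (not_le.2 hgt), _, Or.inl rfl,
      fun h => absurd h (not_le.2 hgt)⟩, ?_⟩
    rw [toBounded, dif_neg (by simpa using hgt)]
    simpa only [hs] using r₂

open StackAutomaton in
theorem run_rows (ws vs : List (Fin I.n)) (h : (vs ++ ws).Nodup)
    (d : List (Fin M → Bool)) (f : List Bool) (hs : I.StacksFor vs d f) :
    ∃ d' f', I.StacksFor (vs ++ ws) d' f' ∧
      (crcsAutomaton k M).ReachesIn (ws.length * (2 * I.n + 2))
        (conf (.rewind (toBounded M ((select I.Twins vs).1.map I.colors)))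
          (ws.flatMap I.block) [] [] d f)
        (conf (.rewind (toBounded M ((select I.Twins (vs ++ ws)).1.map I.colors)))
          [] [] [] d' f') := by
  induction ws generalizing vs d f with
  | nil => exact ⟨d, f, by simpa using hs, by simpa using ReachesIn.refl _ _⟩
  | cons w ws ih =>
    obtain ⟨d₁, f₁, hs₁, r₁⟩ := I.run_row vs ws w (List.nodup_append.1 h).1 d f hs
    obtain ⟨d₂, f₂, hs₂, r₂⟩ := ih (vs ++ [w]) (by simpa using h) d₁ f₁ hs₁
    refine ⟨d₂, f₂, by simpa using hs₂, ?_⟩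
    have := r₁.trans r₂
    rw [List.append_assoc, List.singleton_append] at this
    exact this.mono (by rw [List.length_cons]; ring_nf; omega)

/-- The recorded data determine the instance induced on `us`, so any witness of `Accepts` embeds
onto `us`; `htw` supplies the twins for all other vertices. Bits beyond `us.length` are never
consulted. -/
theorem accepts_iff (us : List (Fin I.n)) (hus : us.Nodup) (hM : us.length ≤ M)
    (htw : ∀ v, v ∈ us ∨ ∃ a ∈ us, ∃ b ∈ us, a ≠ b ∧ I.Twins a v ∧ I.Twins b v)
    (X : Fin I.n → Fin M → Bool)
    (hX : ∀ (j : Fin M) (u : Fin I.n), us[j.1]? = some u → ∀ w, X w j = true ↔ I.graph.Adj u w) :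
    Accepts (us.map I.colors) (us.map X) ↔ IsSplit I.graph ∧ Reconfigurable I.fs I.ft := by
  have key : ∀ J : Instance k, ∀ hn : J.n = us.length,
      (∀ v : Fin J.n, (J.fs v, J.ft v) = I.colors us[v]) →
      (∀ v w : Fin J.n, I.graph.Adj us[v] us[w] ↔ J.graph.Adj v w) →
      (IsSplit I.graph ∧ Reconfigurable I.fs I.ft ↔
        IsSplit J.graph ∧ Reconfigurable J.fs J.ft) := by
    intro J hn hc ha
    let φ : J.graph ↪g I.graph :=
      ⟨⟨fun v => us[v], fun v w h => Fin.ext ((hus.getElem_inj_iff).1 h)⟩, ha _ _⟩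
    have hφ : HasTwins φ I.fs I.ft := by
      intro v hv
      rcases htw v with h | ⟨a, haM, b, hbM, hab, hav, hbv⟩
      · obtain ⟨i, hi, rfl⟩ := List.getElem_of_mem h
        exact absurd ⟨⟨i, hn ▸ hi⟩, rfl⟩ hv
      · obtain ⟨i, hi, rfl⟩ := List.getElem_of_mem haM
        obtain ⟨j, hj, rfl⟩ := List.getElem_of_mem hbM
        refine ⟨⟨i, hn ▸ hi⟩, ⟨j, hn ▸ hj⟩, fun h => hab ?_, ?_⟩
        · simp only [Fin.mk.injEq] at h
          simp [h]
        · rintro c (rfl | rfl)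
          · exact ⟨congrArg Prod.fst hav.1, congrArg Prod.snd hav.1, hav.2⟩
          · exact ⟨congrArg Prod.fst hbv.1, congrArg Prod.snd hbv.1, hbv.2⟩
    exact and_congr hφ.isSplit_iff (hφ.reconfigurable_iff (fun w => congrArg Prod.fst (hc w))
      fun w => congrArg Prod.snd (hc w))
  constructor
  · rintro ⟨J, hc, ha, hJ⟩
    have hn : J.n = us.length := by simpa using congrArg List.length hc
    refine (key J hn (fun v => ?_) fun v w => ?_).2 hJ
    · have := congrArg (fun l => l[v.1]?) hc
      have hv : v.1 < us.length := v.2.trans_eq hn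
      simpa [hv] using this
    · have hv : v.1 < us.length := v.2.trans_eq hn
      have hw : w.1 < us.length := w.2.trans_eq hn
      rw [← ha w (X us[w]) (by simp [hw]) v (hv.trans_le hM)]
      exact (hX ⟨v.1, hv.trans_le hM⟩ us[v] (by simp [hv]) us[w]).symm
  · intro h
    -- The witness is the induced instance, with vertices numbered in the order of selection.
    let J : Instance k :=
      ⟨us.length, I.graph.comap us.get,
        SimpleGraph.Coloring.mk (fun v => I.fs us[v]) fun {_ _} h => I.fs.valid h,
        SimpleGraph.Coloring.mk (fun v => I.ft us[v]) fun {_ _} h => I.ft.valid h⟩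
    refine ⟨J, ?_, fun v x hx w hw => ?_, (key J rfl (fun _ => rfl) fun _ _ => Iff.rfl).1 h⟩
    · refine List.ext_getElem (by simp [J]) fun i h₁ h₂ => ?_
      simp only [List.getElem_map, List.getElem_finRange]
      rfl
    · have hv : v.1 < us.length := v.2
      have hw' : w.1 < us.length := w.2
      obtain rfl : X us[v.1] = x := by simpa [hv] using hx
      exact hX ⟨w.1, hw⟩ us[w.1] (by simp [hw']) us[v.1]

open StackAutomaton in
theorem run_encode : ∃ b : Bool, (b = true ↔ IsSplit I.graph ∧ Reconfigurable I.fs I.ft) ∧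
    (crcsAutomaton k (selectionBound k)).ReachesIn (3 * I.encode.length + 4)
      (conf (.rewind (some (BoundedList.nil _ _))) I.encode [] [] [] [])
      (conf .final [] [b] [] [] []) := by
  classical
  have hnd : (List.finRange I.n).Nodup := List.nodup_finRange _
  have h₀ : I.StacksFor (M := selectionBound k) [] [] [] :=
    ⟨rfl, fun _ => rfl, fun _ _ => false, Or.inr ⟨rfl, rfl, fun _ => rfl⟩, by simp [select]⟩
  obtain ⟨d, f, ⟨hfl, hf, X, hd, hX⟩, r⟩ :=
    I.run_rows (List.finRange I.n) [] (by simpa using hnd) [] [] h₀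
  rw [List.nil_append] at hfl hf hX hd r
  replace hd : d = ((List.finRange I.n).map X).reverse := by
    rcases hd with hd | ⟨h, rfl, -⟩
    · exact hd
    · simp [h]
  have hdl : d.length ≤ I.n := by simp [hd]
  have hfl' : f.length ≤ I.n := by simp [hfl]
  have hstart : toBounded (selectionBound k) ((select I.Twins []).1.map I.colors) =
      some (BoundedList.nil _ _) := rfl
  rw [hstart] at r
  set us := (select I.Twins (List.finRange I.n)).1 with hus
  by_cases hM : us.length ≤ selectionBound k
  · have hs : toBounded (selectionBound k) (us.map I.colors) =
        some ⟨us.map I.colors, by simpa using hM⟩ := by rw [toBounded, dif_pos]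
    rw [hs] at r
    have hsel : (us.map I.colors).length ≤ selectionBound k := by simpa using hM
    have hcols : (us.map X).length ≤ selectionBound k := by simpa using hM
    have r₁ : (crcsAutomaton k (selectionBound k)).ReachesIn (List.finRange I.n).length
        (conf (.collect ⟨us.map I.colors, hsel⟩ (BoundedList.nil _ _)) [] [] [] d f)
        (conf (.collect ⟨us.map I.colors, hsel⟩ ⟨us.map X, hcols⟩) [] [] [] [] []) := by
      have := run_collect I.Twins X ⟨us.map I.colors, hsel⟩ [] []
        (List.finRange I.n) [] [] (BoundedList.nil _ _) (by simpa [BoundedList.nil] using hM)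
      simpa [hd, hf hM, BoundedList.nil] using this
    -- Collecting has emptied the last nonempty stacks, so clearing only has to write the answer.
    refine ⟨_, ?_, ((((r.trans (run_rewind_end_some _ _ _ _)).trans r₁).trans
      (run_collect_end _ _ _ _ _)).trans (run_clear _ 0 _ _ _ _ le_rfl le_rfl le_rfl le_rfl)).mono
      ?_⟩
    · rw [decide_eq_true_iff]
      exact I.accepts_iff us (hnd.sublist (select_sublist _ _)) hM
        (fun v => mem_select_or _ _ v (List.mem_finRange v)) X (hX hM)
    · rw [length_encode, List.length_finRange]
      nlinarith
  · have hs : toBounded (selectionBound k) (us.map I.colors) = none := by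
      rw [toBounded, dif_neg (by simpa using hM)]
    rw [hs] at r
    refine ⟨false, ?_, ((r.trans (run_rewind_end_none _ _ _)).trans
      (run_clear false I.n _ _ _ _ (by simp) (by simp) hdl hfl')).mono ?_⟩
    · simp only [Bool.false_eq_true, false_iff]
      -- Too many selected vertices rule out splitness, so rejecting is correct.
      exact fun h => hM (I.length_select_le_of_isSplit h.1 _ hnd)
    · rw [length_encode, List.length_finRange]
      nlinarith

end Instance

end ColorSwap

theorem mainTheorem9 (k : ℕ) (hk : 0 < k) :
    ColorSwap.SolvableInPolyTime (ColorSwap.Instance.encode (k := k))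
      (fun I => ColorSwap.IsSplit I.graph ∧ ColorSwap.Reconfigurable I.fs I.ft) := by
  refine (ColorSwap.crcsAutomaton k (ColorSwap.selectionBound k)).solvableInPolyTime
    ColorSwap.Stack.inp ColorSwap.Stack.out (Equiv.refl Bool) _ _ (3 * Polynomial.X + 4) fun I => ?_
  obtain ⟨b, hb, r⟩ := I.run_encode
  refine ⟨b, ColorSwap.onStacks (F := List) I.encode [] [] [] [],
    ColorSwap.onStacks (F := List) [] [b] [] [] [], hb, ?_, rfl, ?_, rfl, ?_⟩
  · have hp : (3 * Polynomial.X + 4 : Polynomial ℕ).eval I.encode.length =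
        3 * I.encode.length + 4 := by simp
    rw [hp]
    exact r
  · intro s hs
    cases s <;> first | rfl | exact absurd rfl hs
  · intro s hs
    cases s <;> first | rfl | exact absurd rfl hs
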